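/- Let $H$ be a finite graph without isolated vertices. In the game of Cops and Robbers on $H$, $n$ cops first choose starting vertices (several may share a vertex), then a single robber chooses his; all positions are visible to both sides. The two sides then alternate turns, cops first. In the passive game, on each turn of a side every agent of that side either stays on its vertex or moves to an adjacent vertex; in the fully active game every agent must move to an adjacent vertex on each of its turns. The cops win if at some moment some cop and the robber occupy the same vertex; otherwise the robber wins. Let $c(H)$ and $c_a(H)$ denote the minimum number $n$ of cops that have a winning strategy in the passive game and in the fully active game, respectively. For a graph $G$ and a positive integer $t$, the $t$-blowup $G^{(t)}$ is obtained from $G$ by replacing each vertex $v$ with an independent set $S_v$ of size $t$ and each edge $uv$ with a complete bipartite graph with partite sets $S_u$ and $S_v$. **Theorem.** Let $k \ge 2$, let $T_1, \dots, T_{2k-1}$ be finite trees, each with at least two vertices, and let $G = T_1 \,\Box\, T_2 \,\Box\, \cdots \,\Box\, T_{2k-1}$ be their Cartesian product. Then, for every integer $t \ge 2k$, $$c(G^{(t)}) = k \qquad\text{and}\qquad c_a(G^{(t)}) = 2k .$$ -/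

import Mathlib

namespace CopsRobbers

universe u

variable {V : Type u}

/-- The Cartesian product of a family of graphs: two tuples are adjacent when they differ in
exactly one coordinate, and their entries there are adjacent in the corresponding factor. -/
def cartesianProduct {ι : Type} {V : ι → Type u} (T : ∀ i, SimpleGraph (V i)) :
    SimpleGraph (∀ i, V i) where
  Adj x y := ∃ i, (T i).Adj (x i) (y i) ∧ ∀ j, j ≠ i → x j = y j
  symm := ⟨fun _ _ ⟨i, h, hj⟩ => ⟨i, h.symm, fun j hji => (hj j hji).symm⟩⟩
  loopless := ⟨fun x ⟨i, h, _⟩ => (T i).loopless.irrefl (x i) h⟩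

/-- The `t`-blowup of `G`: each vertex `v` becomes the independent set `{v} × Fin t`, and each
edge becomes a complete bipartite graph. -/
def blowup (G : SimpleGraph V) (t : ℕ) : SimpleGraph (V × Fin t) where
  Adj x y := G.Adj x.1 y.1
  symm := ⟨fun _ _ h => h.symm⟩
  loopless := ⟨fun x h => G.loopless.irrefl x.1 h⟩

/-- A legal move of a single agent in the passive game: stay, or move along an edge. -/
def PassiveMove (G : SimpleGraph V) (v w : V) : Prop := v = w ∨ G.Adj v w

/-- A legal move of a single agent in the fully active game: move along an edge. -/
def ActiveMove (G : SimpleGraph V) (v w : V) : Prop := G.Adj v w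

/-- A strategy for `n` cops: from the list of all robber positions so far (in chronological
order) it gives the positions that the cops take next. Its value at `[]` is the initial
placement, made before the robber chooses his starting vertex. -/
abbrev CopStrategy (V : Type u) (n : ℕ) : Type u := List V → Fin n → V

/-- The positions of the cops after `m` cop turns, when they use `σ` and `r 0, r 1, …` are the
successive positions of the robber. -/
def copPos {n : ℕ} (σ : CopStrategy V n) (r : ℕ → V) (m : ℕ) : Fin n → V :=
  σ ((List.range m).map r)

/-- The strategy `σ` is winning if, against every legal play `r` of the robber, all cop moves are
legal and at some moment a cop and the robber occupy the same vertex. The turn order is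
`copPos σ r 0`, `r 0`, `copPos σ r 1`, `r 1`, …, so the robber is at `r m` from the moment the cops
stand at `copPos σ r m` until after they have moved to `copPos σ r (m + 1)`. -/
def CopStrategy.IsWinning {n : ℕ} (move : V → V → Prop) (σ : CopStrategy V n) : Prop :=
  ∀ r : ℕ → V, (∀ m, move (r m) (r (m + 1))) →
    (∀ m i, move (copPos σ r m i) (copPos σ r (m + 1) i)) ∧
      ∃ m i, copPos σ r m i = r m ∨ copPos σ r (m + 1) i = r m

/-- `n` cops have a winning strategy in the game whose agents all move according to `move`. -/
def CopsWin (move : V → V → Prop) (n : ℕ) : Prop :=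
  ∃ σ : CopStrategy V n, CopStrategy.IsWinning move σ

/-- The passive cop number: the least number of cops with a winning strategy in the passive game.
(A positive value is attained, being the infimum of a nonempty set of natural numbers.) -/
noncomputable def passiveCopNumber (G : SimpleGraph V) : ℕ :=
  sInf {n : ℕ | CopsWin (PassiveMove G) n}

/-- The fully active cop number: the least number of cops with a winning strategy in the fully
active game, played on a graph without isolated vertices, so that every agent can always move. -/
noncomputable def activeCopNumber (G : SimpleGraph V) : ℕ :=
  sInf {n : ℕ | CopsWin (ActiveMove G) n}

end CopsRobbers

/-! Moves in the blowup project to moves in the product, and a moving agent chooses its copy freely.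
In the product, distance is the sum of the tree distances, and every move along an edge flips its
parity.

Upper bounds: a cop in charge of one or two coordinates has a lexicographic `potential`: the
territory left to the robber in the other coordinates, then the imbalance of the distances in its
own two, then its own territories. It can answer every robber step without raising the potential,
and lowers it if the step was in an own coordinate (`exists_potential_le`). With two coordinates
this requires even distance before the robber's step. If the cops share out all coordinates, the
vector of potentials drops each round. In the passive game `k` cops suffice: one of them has a
single coordinate, needs no parity, and uses up the robber's passes. In the active game parity
cannot be corrected, so each parity class gets a team of `k`.

Lower bounds: the robber has an exit in each of the `2k - 1` directions, and a cop off his base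
vertex guards at most two of them, so `k - 1` cops cannot guard all. In the active game only one
parity class of cops can ever capture by its own move. Against at most `2k - 1` cops the robber
starts so that this class has at most `k - 1` members; the others he merely must not walk into, and
a free copy is always available. -/

namespace CopsRobbers

universe u

/-! ### Territory in a single tree -/

/-- The number of vertices that can be reached from `y` without visiting `x`. -/
noncomputable def territory {W : Type u} (G : SimpleGraph W) (x y : W) : ℕ :=
  {z | ∃ p : G.Walk y z, x ∉ p.support}.ncard

theorem territory_self {W : Type u} (G : SimpleGraph W) (x : W) : territory G x x = 0 := by
  simp [territory]

/-- A robber not standing on `x` stays in his component of `G - x`, or steps onto `x` and has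
territory zero. -/
theorem territory_le_of_adj {W : Type u} [Finite W] {G : SimpleGraph W} {x y y' : W}
    (h : G.Adj y y') (hxy : x ≠ y) : territory G x y' ≤ territory G x y := by
  refine Set.ncard_le_ncard ?_ (Set.toFinite _)
  rintro z ⟨p, hp⟩
  exact ⟨SimpleGraph.Walk.cons h p, by simp [hp, hxy]⟩

theorem territory_pos {W : Type u} [Finite W] {G : SimpleGraph W} {x y : W} (hxy : x ≠ y) :
    0 < territory G x y :=
  (Set.ncard_pos (Set.toFinite _)).2 ⟨y, SimpleGraph.Walk.nil, by simpa using hxy⟩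

/-- In a tree a step towards `y` decreases both the distance to `y` and the territory of `y`. -/
theorem exists_adj_territory_lt {W : Type u} [Finite W] {G : SimpleGraph W} (hG : G.IsTree)
    {x y : W} (hxy : x ≠ y) :
    ∃ x', G.Adj x x' ∧ G.dist x' y + 1 = G.dist x y ∧ territory G x' y < territory G x y := by
  classical
  obtain ⟨q, hq, hlen⟩ := hG.connected.exists_path_of_dist x y
  cases q with
  | nil => exact absurd rfl hxy
  | @cons _ x' _ h q' =>
    rw [SimpleGraph.Walk.cons_isPath_iff] at hq
    refine ⟨x', h, ?_, ?_⟩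
    · have h1 := SimpleGraph.dist_le q'
      have h2 := hG.connected.dist_triangle (u := x) (v := x') (w := y)
      rw [SimpleGraph.dist_eq_one_iff_adj.2 h] at h2
      simp only [SimpleGraph.Walk.length_cons] at hlen
      omega
    · refine Set.ncard_lt_ncard ?_ (Set.toFinite _)
      refine Set.ssubset_iff_exists.2 ⟨?_, x', ⟨q'.reverse, by simpa using hq.2⟩, ?_⟩
      -- A walk from `y` that meets `x` contains the unique path from `y` to `x`, hence also `x'`.
      · rintro z ⟨p, hp⟩
        refine ⟨p, fun hx => hp ?_⟩
        have hpath : (SimpleGraph.Walk.cons h q').reverse.IsPath := by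
          rw [SimpleGraph.Walk.isPath_reverse_iff, SimpleGraph.Walk.cons_isPath_iff]; exact hq
        have huniq : (⟨_, hpath⟩ : G.Path y x) =
            ⟨(p.takeUntil x hx).bypass, SimpleGraph.Walk.bypass_isPath _⟩ :=
          (hG.isAcyclic.subsingleton_path y x).elim _ _
        have hmem : x' ∈ (p.takeUntil x hx).bypass.support := by
          rw [← congrArg (fun w : G.Path y x => w.1.support) huniq]
          simp
        exact p.support_takeUntil_subset_support hx
          (SimpleGraph.Walk.support_bypass_subset_support _ hmem)
      · rintro ⟨p, hp⟩
        exact hp p.end_mem_support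

/-! ### The potential of one cop and its answers to the robber -/

section Potential

variable {ι : Type} {V : ι → Type u} {T : ∀ i, SimpleGraph (V i)}

theorem exists_adj_coordinate [DecidableEq ι] [∀ i, Finite (V i)] (hT : ∀ i, (T i).IsTree)
    {x y : ∀ i, V i} {j : ι} (hj : x j ≠ y j) : ∃ x', (cartesianProduct T).Adj x x' ∧ (∀ l, l ≠ j → x' l = x l) ∧
      (T j).dist (x' j) (y j) + 1 = (T j).dist (x j) (y j) ∧
      territory (T j) (x' j) (y j) < territory (T j) (x j) (y j) := by
  obtain ⟨w, hw, hd, ht⟩ := exists_adj_territory_lt (hT j) hj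
  refine ⟨Function.update x j w, ⟨j, by simpa using hw, fun l hl => ?_⟩, fun l hl => ?_, ?_, ?_⟩
  · simp [hl]
  · simp [hl]
  · simpa using hd
  · simpa using ht

variable [Fintype ι]

/-- The sum of the coordinate distances. -/
noncomputable def distSum (T : ∀ i, SimpleGraph (V i)) (x y : ∀ i, V i) : ℕ :=
  ∑ j, (T j).dist (x j) (y j)

theorem distSum_comm (x y : ∀ i, V i) : distSum T x y = distSum T y x := by
  simp only [distSum, SimpleGraph.dist_comm]

theorem distSum_self (x : ∀ i, V i) : distSum T x x = 0 := by
  simp [distSum]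

variable [DecidableEq ι]

/-- The potential of a cop at `x` against a robber at `y`, when the cop is in charge of the
coordinates `a` and `b`. -/
noncomputable def potential (T : ∀ i, SimpleGraph (V i)) (a b : ι) (x y : ∀ i, V i) :
    ℕ ×ₗ ℕ ×ₗ ℕ :=
  toLex (∑ j ∈ Finset.univ \ {a, b}, territory (T j) (x j) (y j),
    -- The two truncated differences add up to the absolute difference; it is zero when `a = b`.
    toLex (((T a).dist (x a) (y a) - (T b).dist (x b) (y b)) +
        ((T b).dist (x b) (y b) - (T a).dist (x a) (y a)),
      territory (T a) (x a) (y a) + territory (T b) (x b) (y b)))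

theorem potential_comm (T : ∀ i, SimpleGraph (V i)) (a b : ι) (x y : ∀ i, V i) :
    potential T a b x y = potential T b a x y := by
  simp only [potential, Finset.pair_comm a b, add_comm]

/-- Trees are bipartite, so one step in one coordinate changes exactly one summand, by one. -/
theorem even_distSum_iff_of_adj (hT : ∀ i, (T i).IsTree) {y y' : ∀ i, V i} (x : ∀ i, V i)
    (h : (cartesianProduct T).Adj y y') : Even (distSum T x y') ↔ ¬ Even (distSum T x y) := by
  obtain ⟨j, hj, hne⟩ := h
  have h1 : ∑ l ∈ Finset.univ.erase j, (T l).dist (x l) (y' l) =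
      ∑ l ∈ Finset.univ.erase j, (T l).dist (x l) (y l) :=
    Finset.sum_congr rfl fun l hl => by rw [hne l (Finset.ne_of_mem_erase hl)]
  rw [distSum, distSum, ← Finset.add_sum_erase _ _ (Finset.mem_univ j),
    ← Finset.add_sum_erase _ _ (Finset.mem_univ j), h1]
  have h2 := (hT j).dist_eq_dist_add_one_of_adj (x j) hj
  rcases h2 with h2 | h2 <;> rw [h2] <;> grind

theorem even_distSum_iff_of_adj_left (hT : ∀ i, (T i).IsTree) {x x' : ∀ i, V i} (y : ∀ i, V i)
    (h : (cartesianProduct T).Adj x x') : Even (distSum T x' y) ↔ ¬ Even (distSum T x y) := by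
  rw [distSum_comm x' y, distSum_comm x y]
  exact even_distSum_iff_of_adj hT y h

theorem potential_lt_of_fst_lt {a b : ι} {x y x' y' : ∀ i, V i}
    (h : ∑ j ∈ Finset.univ \ {a, b}, territory (T j) (x' j) (y' j) <
      ∑ j ∈ Finset.univ \ {a, b}, territory (T j) (x j) (y j)) :
    potential T a b x' y' < potential T a b x y :=
  Prod.Lex.toLex_lt_toLex.2 (Or.inl h)

theorem sum_territory_lt {a b j : ι} {x y x' : ∀ i, V i}
    (hj : j ≠ a ∧ j ≠ b) (hl : ∀ l, l ≠ j → x' l = x l)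
    (ht : territory (T j) (x' j) (y j) < territory (T j) (x j) (y j)) :
    ∑ j ∈ Finset.univ \ {a, b}, territory (T j) (x' j) (y j) <
      ∑ j ∈ Finset.univ \ {a, b}, territory (T j) (x j) (y j) := by
  refine Finset.sum_lt_sum (fun l _ => ?_) ⟨j, by simp [hj], ht⟩
  by_cases h : l = j
  · subst h; exact ht.le
  · rw [hl l h]

theorem sum_territory_eq_zero {a b : ι} {x y : ∀ i, V i}
    (h : ∀ j, j ≠ a → j ≠ b → x j = y j) :
    ∑ j ∈ Finset.univ \ {a, b}, territory (T j) (x j) (y j) = 0 :=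
  Finset.sum_eq_zero fun j hj => by
    simp only [Finset.mem_sdiff, Finset.mem_univ, Finset.mem_insert, Finset.mem_singleton,
      true_and, not_or] at hj
    rw [h j hj.1 hj.2, territory_self]

/-- A free tempo of a cop in charge of a single coordinate. -/
theorem exists_potential_lt_of_pass [∀ i, Finite (V i)] (hT : ∀ i, (T i).IsTree) (a : ι)
    {x y : ∀ i, V i} (hxy : x ≠ y) :
    ∃ x', (cartesianProduct T).Adj x x' ∧ potential T a a x' y < potential T a a x y := by
  by_cases h : ∃ j, j ≠ a ∧ x j ≠ y j
  · obtain ⟨j, hja, hj⟩ := h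
    obtain ⟨x', hadj, hl, -, ht⟩ := exists_adj_coordinate hT hj
    exact ⟨x', hadj, potential_lt_of_fst_lt (sum_territory_lt ⟨hja, hja⟩ hl ht)⟩
  · push Not at h
    have ha : x a ≠ y a := fun ha => hxy (funext fun j => by
      by_cases hj : j = a
      · subst hj; exact ha
      · exact h j hj)
    obtain ⟨x', hadj, hl, -, ht⟩ := exists_adj_coordinate hT ha
    refine ⟨x', hadj, ?_⟩
    rw [potential, potential, sum_territory_eq_zero fun j hj _ => h j hj,
      sum_territory_eq_zero fun j hj _ => (hl j hj).trans (h j hj)]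
    refine Prod.Lex.toLex_lt_toLex.2 (Or.inr ⟨rfl, Prod.Lex.toLex_lt_toLex.2 (Or.inr ⟨?_, ?_⟩)⟩) <;>
      dsimp only <;> omega

theorem sum_dist_eq_of_eq {a b : ι} (hab : a ≠ b) {x y : ∀ i, V i}
    (h : ∀ j, j ≠ a → j ≠ b → x j = y j) :
    distSum T x y = (T a).dist (x a) (y a) + (T b).dist (x b) (y b) := by
  rw [distSum, ← Finset.sum_subset (Finset.subset_univ {a, b}), Finset.sum_pair hab]
  intro j _ hj
  simp only [Finset.mem_insert, Finset.mem_singleton, not_or] at hj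
  rw [h j hj.1 hj.2, SimpleGraph.dist_self]

/-- The answer to a robber move in an own coordinate, once all other coordinates agree. -/
theorem exists_potential_lt_of_agree [∀ i, Finite (V i)] (hT : ∀ i, (T i).IsTree) {a b : ι}
    {x y y' : ∀ i, V i} (hxy : x ≠ y) (hxy' : x ≠ y')
    (hadj : (T a).Adj (y a) (y' a)) (hne : ∀ l, l ≠ a → y l = y' l)
    (heven : a = b ∨ Even (distSum T x y)) (hagree : ∀ j, j ≠ a → j ≠ b → x j = y j) :
    ∃ x', (cartesianProduct T).Adj x x' ∧ potential T a b x' y' < potential T a b x y := by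
  have hagree' : ∀ j, j ≠ a → j ≠ b → x j = y' j := fun j h1 h2 =>
    (hagree j h1 h2).trans (hne j h1)
  have hzero {j : ι} {u v : ∀ i, V i} : (T j).dist (u j) (v j) = 0 ↔ u j = v j :=
    (hT j).connected.dist_eq_zero_iff
  by_cases hab : a = b
  · subst hab
    have ha : x a ≠ y a := fun ha => hxy (funext fun j => by
      by_cases hj : j = a
      · subst hj; exact ha
      · exact hagree j hj hj)
    have ha' : x a ≠ y' a := fun ha => hxy' (funext fun j => by
      by_cases hj : j = a
      · subst hj; exact ha
      · exact hagree' j hj hj)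
    obtain ⟨x', hx, hl, -, ht⟩ := exists_adj_coordinate hT ha'
    refine ⟨x', hx, ?_⟩
    have := territory_le_of_adj hadj ha
    rw [potential, potential, sum_territory_eq_zero hagree,
      sum_territory_eq_zero fun j h1 h2 => (hl j h1).trans (hagree' j h1 h2)]
    refine Prod.Lex.toLex_lt_toLex.2 (Or.inr ⟨rfl, Prod.Lex.toLex_lt_toLex.2 (Or.inr ⟨?_, ?_⟩)⟩) <;>
      dsimp only <;> omega
  have heven := heven.resolve_left hab
  rw [sum_dist_eq_of_eq hab hagree] at heven
  have hb : y b = y' b := hne b (Ne.symm hab)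
  have hflip := (hT a).dist_eq_dist_add_one_of_adj (x a) hadj
  have hpos : (T a).dist (x a) (y a) ≠ 0 ∨ (T b).dist (x b) (y b) ≠ 0 := by
    by_contra! h
    refine hxy (funext fun j => ?_)
    by_cases hja : j = a
    · subst hja; exact hzero.1 h.1
    by_cases hjb : j = b
    · subst hjb; exact hzero.1 h.2
    exact hagree j hja hjb
  have hterr : x a ≠ y a → territory (T a) (x a) (y' a) ≤ territory (T a) (x a) (y a) :=
    territory_le_of_adj hadj
  rw [ne_eq, ← hzero] at hterr
  -- After the robber's step the two distances have odd sum, hence differ; the cop steps in the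
  -- larger one. The imbalance does not grow overall. If it stays the same, the own territories
  -- shrink; the robber's step can enlarge one only if `x a = y a`, and then the imbalance drops.
  by_cases hlt : (T b).dist (x b) (y b) < (T a).dist (x a) (y' a)
  · have ha' : x a ≠ y' a := fun h => by rw [hzero.2 h] at hlt; omega
    obtain ⟨x', hx, hl, hd, ht⟩ := exists_adj_coordinate hT ha'
    refine ⟨x', hx, ?_⟩
    rw [potential, potential, sum_territory_eq_zero hagree,
      sum_territory_eq_zero fun j h1 h2 => (hl j h1).trans (hagree' j h1 h2), hl b (Ne.symm hab),
      ← hb]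
    simp only [Prod.Lex.toLex_lt_toLex, lt_self_iff_false, false_or, true_and]
    grind
  · have hb' : x b ≠ y' b := fun h => by
      rw [← hb, ← hzero] at h
      grind
    obtain ⟨x', hx, hl, hd, ht⟩ := exists_adj_coordinate hT hb'
    refine ⟨x', hx, ?_⟩
    rw [← hb] at hd ht
    rw [potential, potential, sum_territory_eq_zero hagree,
      sum_territory_eq_zero fun j h1 h2 => (hl j h2).trans (hagree' j h1 h2), hl a hab,
      ← hb]
    simp only [Prod.Lex.toLex_lt_toLex, lt_self_iff_false, false_or, true_and]
    grind

/-- The answer of a cop in charge of `a` and `b` to a robber move: the potential does not grow, and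
it drops when the robber moves in one of the coordinates `a`, `b`. -/
theorem exists_potential_le [∀ i, Finite (V i)] (hT : ∀ i, (T i).IsTree) {a b j : ι}
    {x y y' : ∀ i, V i} (hxy : x ≠ y) (hxy' : x ≠ y')
    (hadj : (T j).Adj (y j) (y' j)) (hne : ∀ l, l ≠ j → y l = y' l)
    (heven : a = b ∨ Even (distSum T x y)) :
    ∃ x', (cartesianProduct T).Adj x x' ∧ potential T a b x' y' ≤ potential T a b x y ∧
      (j = a ∨ j = b → potential T a b x' y' < potential T a b x y) := by
  by_cases hfollow : j ≠ a ∧ j ≠ b ∧ x j = y j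
  -- Copying the robber in an already matched foreign coordinate is the one answer that brings no
  -- decrease.
  · obtain ⟨hja, hjb, hj⟩ := hfollow
    refine ⟨Function.update x j (y' j), ⟨j, by simpa [hj] using hadj, fun l hl => by simp [hl]⟩,
      le_of_eq ?_, by tauto⟩
    have hsum : ∑ l ∈ Finset.univ \ {a, b},
        territory (T l) (Function.update x j (y' j) l) (y' l) =
        ∑ l ∈ Finset.univ \ {a, b}, territory (T l) (x l) (y l) := by
      refine Finset.sum_congr rfl fun l _ => ?_
      by_cases hl : l = j
      · subst hl; simp [hj, territory_self]
      · simp [hl, hne l hl]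
    rw [potential, potential, hsum]
    simp [Ne.symm hja, Ne.symm hjb, hne a (Ne.symm hja), hne b (Ne.symm hjb)]
  suffices h : ∃ x', (cartesianProduct T).Adj x x' ∧ potential T a b x' y' < potential T a b x y by
    obtain ⟨x', hx, hlt⟩ := h
    exact ⟨x', hx, hlt.le, fun _ => hlt⟩
  have hle : ∀ l, l ≠ a → l ≠ b →
      territory (T l) (x l) (y' l) ≤ territory (T l) (x l) (y l) := fun l hla hlb => by
    by_cases hl : l = j
    · subst hl
      exact territory_le_of_adj hadj fun h => hfollow ⟨hla, hlb, h⟩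
    · rw [hne l hl]
  have hsum : ∑ l ∈ Finset.univ \ {a, b}, territory (T l) (x l) (y' l) ≤
      ∑ l ∈ Finset.univ \ {a, b}, territory (T l) (x l) (y l) :=
    Finset.sum_le_sum fun l hl => by
      simp only [Finset.mem_sdiff, Finset.mem_univ, Finset.mem_insert, Finset.mem_singleton,
        true_and, not_or] at hl
      exact hle l hl.1 hl.2
  by_cases hout : ∃ l, l ≠ a ∧ l ≠ b ∧ x l ≠ y' l
  · obtain ⟨l, hla, hlb, hl⟩ := hout
    obtain ⟨x', hx, hl', -, ht⟩ := exists_adj_coordinate hT hl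
    exact ⟨x', hx, potential_lt_of_fst_lt ((sum_territory_lt ⟨hla, hlb⟩ hl' ht).trans_le hsum)⟩
  push Not at hout
  by_cases hja : j = a
  · subst hja
    exact exists_potential_lt_of_agree hT hxy hxy' hadj hne heven
      fun l hl hlb => (hout l hl hlb).trans (hne l hl).symm
  by_cases hjb : j = b
  · subst hjb
    simp only [potential_comm T a j]
    exact exists_potential_lt_of_agree hT hxy hxy' hadj hne (heven.imp_left Eq.symm)
      fun l hl hla => (hout l hla hl).trans (hne l hl).symm
  -- The robber has just stepped onto `x j` in a foreign coordinate. The foreign territory falls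
  -- from positive to zero, so any step in an own coordinate will do.
  have hxj : x j ≠ y j := fun h => hfollow ⟨hja, hjb, h⟩
  have hown : ∃ l, (l = a ∨ l = b) ∧ x l ≠ y' l := by
    obtain ⟨l, hl⟩ := Function.ne_iff.1 hxy'
    refine ⟨l, ?_, hl⟩
    by_contra! h
    exact hl (hout l h.1 h.2)
  obtain ⟨l, hlab, hl⟩ := hown
  obtain ⟨x', hx, hl', -, -⟩ := exists_adj_coordinate hT hl
  refine ⟨x', hx, potential_lt_of_fst_lt ?_⟩
  rw [sum_territory_eq_zero fun i hia hib => (hl' i (by rintro rfl; tauto)).trans (hout i hia hib)]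
  refine Finset.sum_pos' (fun _ _ => Nat.zero_le _) ⟨j, by simp [hja, hjb], territory_pos hxj⟩

end Potential

/-! ### Composing strategies of the cops and of the robber -/

section Game

variable {W : Type u} {n : ℕ} {move : W → W → Prop}

/-- Cops standing at `c` can force a capture when the robber's next position belongs to `S`. -/
def ForcesFrom (move : W → W → Prop) (c : Fin n → W) (S : Set W) : Prop :=
  ∃ σ : CopStrategy W n, σ [] = c ∧ ∀ r : ℕ → W, r 0 ∈ S → (∀ m, move (r m) (r (m + 1))) →
    (∀ m i, move (copPos σ r m i) (copPos σ r (m + 1) i)) ∧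
      ∃ m i, copPos σ r m i = r m ∨ copPos σ r (m + 1) i = r m

theorem ForcesFrom.copsWin {c : Fin n → W} (h : ForcesFrom move c Set.univ) : CopsWin move n := by
  obtain ⟨σ, -, hσ⟩ := h
  exact ⟨σ, fun r hr => hσ r trivial hr⟩

/-- One round of play: the continuations, one for each robber position, are glued by branching on
the head of the history. This lets capture be proved by induction on positions. -/
theorem forcesFrom_of_step (hmove : ∀ v, ∃ w, move v w) {c : Fin n → W} {S : Set W}
    (h : ∀ y ∈ S, ∃ c' : Fin n → W, (∀ i, move (c i) (c' i)) ∧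
      ((∃ i, c i = y ∨ c' i = y) ∨ ForcesFrom move c' {z | move y z})) :
    ForcesFrom move c S := by
  choose nxt hnxt using hmove
  have key : ∀ y, ∃ τ : CopStrategy W n, y ∈ S → (∀ i, move (c i) (τ [] i)) ∧
      ∀ r : ℕ → W, move y (r 0) → (∀ m, move (r m) (r (m + 1))) →
        (∀ m i, move (copPos τ r m i) (copPos τ r (m + 1) i)) ∧
          ((∃ i, c i = y ∨ τ [] i = y) ∨
            ∃ m i, copPos τ r m i = r m ∨ copPos τ r (m + 1) i = r m) := by
    intro y
    by_cases hy : y ∈ S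
    · obtain ⟨c', hc', hcap | ⟨τ, hτ, hwin⟩⟩ := h y hy
      -- Winning demands legal cop moves forever, so after a capture the cops go on with arbitrary
      -- legal moves.
      · refine ⟨fun l i => nxt^[l.length] (c' i), fun _ => ⟨hc', fun r _ _ => ⟨fun m i => ?_,
          Or.inl hcap⟩⟩⟩
        simp only [copPos, List.length_map, List.length_range, Function.iterate_succ_apply']
        exact hnxt _
      · refine ⟨τ, fun _ => ⟨by rwa [hτ], fun r h0 hr => ?_⟩⟩
        exact ⟨(hwin r h0 hr).1, Or.inr (hwin r h0 hr).2⟩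
    · exact ⟨fun _ => c, fun h => absurd h hy⟩
  choose τ hτ using key
  let σ : CopStrategy W n := fun l => match l with
    | [] => c
    | y :: l => τ y l
  have hσ : ∀ (r : ℕ → W) m, copPos σ r (m + 1) = copPos (τ (r 0)) (fun m => r (m + 1)) m := by
    intro r m
    simp only [copPos, List.range_succ_eq_map, List.map_cons, List.map_map, σ]
    rfl
  refine ⟨σ, rfl, fun r h0 hr => ?_⟩
  obtain ⟨h1, h2⟩ := hτ (r 0) h0
  obtain ⟨h3, h4⟩ := h2 (fun m => r (m + 1)) (hr 0) fun m => hr (m + 1)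
  have hσ0 : copPos σ r 0 = c := rfl
  have hσ1 : copPos σ r 1 = τ (r 0) [] := hσ r 0
  constructor
  · rintro (_ | m) i
    · rw [hσ0, zero_add, hσ1]; exact h1 i
    · rw [hσ, hσ]; exact h3 m i
  · rcases h4 with ⟨i, hi⟩ | ⟨m, i, hi⟩
    · exact ⟨0, i, by rwa [zero_add, hσ0, hσ1]⟩
    · exact ⟨m + 1, i, by rwa [hσ, hσ]⟩

/-- The robber wins when he can preserve a relation between the cops' positions and his own. -/
theorem not_copsWin_of_evade (hmove : ∀ v, ∃ w, move v w) (Safe : (Fin n → W) → W → Prop)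
    (hinit : ∀ c, ∃ y, Safe c y) (hne : ∀ c y, Safe c y → ∀ i, c i ≠ y)
    (hstep : ∀ c c' y, Safe c y → (∀ i, move (c i) (c' i)) →
      (∀ i, c' i ≠ y) ∧ ∃ y', move y y' ∧ Safe c' y') : ¬ CopsWin move n := by
  rintro ⟨σ, hσ⟩
  -- The reply is legal even if no safe one exists: legality of the robber's play is needed to
  -- obtain legality of the cops' moves, on which safety depends.
  have hnext : ∀ c' y, ∃ y', move y y' ∧ ((∃ z, move y z ∧ Safe c' z) → Safe c' y') := by
    intro c' y
    by_cases h : ∃ z, move y z ∧ Safe c' z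
    · obtain ⟨z, hz⟩ := h
      exact ⟨z, hz.1, fun _ => hz.2⟩
    · obtain ⟨w, hw⟩ := hmove y
      exact ⟨w, hw, fun h' => absurd h' h⟩
  choose next hnext1 hnext2 using hnext
  obtain ⟨y0, hy0⟩ := hinit (σ [])
  let H : ℕ → List W × W := fun m => Nat.rec ([], y0)
    (fun _ p => (p.1 ++ [p.2], next (σ (p.1 ++ [p.2])) p.2)) m
  let r : ℕ → W := fun m => (H m).2
  have hH : ∀ m, (List.range m).map r = (H m).1 := by
    intro m
    induction m with
    | zero => rfl
    | succ m ih => rw [List.range_succ, List.map_append, ih]; rfl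
  have hr : ∀ m, r (m + 1) = next (copPos σ r (m + 1)) (r m) := by
    intro m
    rw [copPos, hH]
  obtain ⟨hlegal, m, i, hcap⟩ := hσ r fun m => by rw [hr]; exact hnext1 _ _
  have hsafe : ∀ m, Safe (copPos σ r m) (r m) := by
    intro m
    induction m with
    | zero => exact hy0
    | succ m ih =>
      rw [hr]
      exact hnext2 _ _ (hstep _ _ _ ih (hlegal m)).2
  rcases hcap with hcap | hcap
  · exact hne _ _ (hsafe m) i hcap
  · exact (hstep _ _ _ (hsafe m) (hlegal m)).1 i hcap

end Game

theorem passiveMove_exists {W : Type u} {G : SimpleGraph W} (v : W) : ∃ w, PassiveMove G v w :=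
  ⟨v, Or.inl rfl⟩

/-! ### Winning strategies for the cops -/

section Capture

variable {ι : Type} [Fintype ι] [DecidableEq ι] {V : ι → Type u} [∀ i, Finite (V i)]
  {T : ∀ i, SimpleGraph (V i)} {t n : ℕ}

/-- The potentials of the useful cops. -/
noncomputable def potentials (T : ∀ i, SimpleGraph (V i)) (a b : Fin n → ι) (U : Fin n → Prop)
    (c : Fin n → (∀ i, V i) × Fin t) (y : (∀ i, V i) × Fin t) : {i // U i} → ℕ ×ₗ ℕ ×ₗ ℕ :=
  fun i => potential T (a i) (b i) (c i).1 y.1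

/-- `U` selects the cops of the right parity; the others move arbitrarily. Even distance recurs
every round, so the robber cannot step into a useful cop's fibre, and a useful cop entering his
fibre picks his very copy. -/
theorem forcesFrom_active (hT : ∀ i, (T i).IsTree)
    (hnbr : ∀ v : ∀ i, V i, ∃ w, (cartesianProduct T).Adj v w)
    (a b : Fin n → ι) (U : Fin n → Prop) (hcov : ∀ j, ∃ i, U i ∧ (j = a i ∨ j = b i))
    (c : Fin n → (∀ i, V i) × Fin t) (y : (∀ i, V i) × Fin t)
    (hc : ∀ i, U i → (c i).1 ≠ y.1 ∧ Even (distSum T (c i).1 y.1)) :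
    ForcesFrom (ActiveMove (blowup (cartesianProduct T) t)) c
      {z | ActiveMove (blowup (cartesianProduct T) t) y z} := by
  induction hp : potentials T a b U c y using WellFoundedLT.induction generalizing c y with
  | _ p ih =>
  subst hp
  refine forcesFrom_of_step (fun v => (hnbr v.1).imp' (fun w => (w, v.2)) fun _ h => h) ?_
  intro y' (hy : (cartesianProduct T).Adj y.1 y'.1)
  obtain ⟨j, hj, hne⟩ := id hy
  have hresp : ∀ i, ∃ w, (cartesianProduct T).Adj (c i).1 w ∧ (U i →
      potential T (a i) (b i) w y'.1 ≤ potential T (a i) (b i) (c i).1 y.1 ∧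
      (j = a i ∨ j = b i →
        potential T (a i) (b i) w y'.1 < potential T (a i) (b i) (c i).1 y.1)) := by
    intro i
    by_cases hi : U i
    · have hxy' : (c i).1 ≠ y'.1 := fun h => by
        have := even_distSum_iff_of_adj hT (c i).1 hy
        rw [h, distSum_self] at this
        exact this.1 Even.zero (h ▸ (hc i hi).2)
      obtain ⟨w, hw, h⟩ := exists_potential_le hT (hc i hi).1 hxy' hj hne
        (Or.inr (hc i hi).2) (a := a i) (b := b i)
      exact ⟨w, hw, fun _ => h⟩
    · obtain ⟨w, hw⟩ := hnbr (c i).1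
      exact ⟨w, hw, fun h => absurd h hi⟩
  choose w hw hpot using hresp
  by_cases hcap : ∃ i, w i = y'.1
  · obtain ⟨i, hi⟩ := hcap
    exact ⟨fun i => (w i, y'.2), hw, Or.inl ⟨i, Or.inr (Prod.ext hi rfl)⟩⟩
  push Not at hcap
  refine ⟨fun i => (w i, y'.2), hw, Or.inr (ih _ ?_ _ _ (fun i hi => ⟨hcap i, ?_⟩) rfl)⟩
  · refine Pi.lt_def.2 ⟨fun i => (hpot i i.2).1, ?_⟩
    obtain ⟨i, hi, hji⟩ := hcov j
    exact ⟨⟨i, hi⟩, (hpot i hi).2 hji⟩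
  · show Even (distSum T (w i) y'.1)
    rw [even_distSum_iff_of_adj_left hT _ (hw i), even_distSum_iff_of_adj hT _ hy, not_not]
    exact (hc i hi).2

/-- A cop in the fibre of the robber pins him down, and a second cop comes to catch him. -/
theorem forcesFrom_passive_of_fibre_of_ne [Nonempty ι] (hT : ∀ i, (T i).IsTree)
    {i₀ i₁ : Fin n} (hi : i₁ ≠ i₀) (c : Fin n → (∀ i, V i) × Fin t) (y : (∀ i, V i) × Fin t)
    (h₀ : (c i₀).1 = y.1) (h₁ : (c i₁).1 ≠ y.1) :
    ForcesFrom (PassiveMove (blowup (cartesianProduct T) t)) c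
      {z | PassiveMove (blowup (cartesianProduct T) t) y z} := by
  obtain ⟨a⟩ := ‹Nonempty ι›
  induction hp : potential T a a (c i₁).1 y.1 using WellFoundedLT.induction generalizing c with
  | _ p ih =>
  subst hp
  refine forcesFrom_of_step passiveMove_exists ?_
  rintro y' (rfl | hy)
  · obtain ⟨w, hw, hlt⟩ := exists_potential_lt_of_pass hT a h₁
    refine ⟨Function.update c i₁ (w, y.2), fun i => ?_, ?_⟩
    · by_cases h : i = i₁
      · subst h; right; simpa [blowup] using hw
      · left; simp [h]
    · by_cases hwy : w = y.1
      · exact Or.inl ⟨i₁, Or.inr (by simp [hwy])⟩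
      · exact Or.inr (ih _ (by simpa using hlt) _ (by simpa [Ne.symm hi] using h₀)
          (by simpa using hwy) rfl)
  · refine ⟨Function.update c i₀ y', fun i => ?_, Or.inl ⟨i₀, Or.inr (by simp)⟩⟩
    by_cases h : i = i₀
    · subst h; right; simpa [blowup, h₀] using hy
    · left; simp [h]

/-- Fibres are independent, so a second cop that also sits in the robber's fibre has to step out
before it can come back onto his copy. -/
theorem forcesFrom_passive_of_fibre [Nonempty ι] (hT : ∀ i, (T i).IsTree)
    (hnbr : ∀ v : ∀ i, V i, ∃ w, (cartesianProduct T).Adj v w) (hn : 2 ≤ n)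
    {i₀ : Fin n} (c : Fin n → (∀ i, V i) × Fin t) (y : (∀ i, V i) × Fin t)
    (h₀ : (c i₀).1 = y.1) :
    ForcesFrom (PassiveMove (blowup (cartesianProduct T) t)) c
      {z | PassiveMove (blowup (cartesianProduct T) t) y z} := by
  have : Nontrivial (Fin n) := Fin.nontrivial_iff_two_le.2 hn
  obtain ⟨i₁, hi⟩ := exists_ne i₀
  by_cases h₁ : (c i₁).1 = y.1
  · refine forcesFrom_of_step passiveMove_exists ?_
    rintro y' (rfl | hy)
    · obtain ⟨w, hw⟩ := hnbr y.1
      refine ⟨Function.update c i₁ (w, y.2), fun i => ?_, Or.inr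
        (forcesFrom_passive_of_fibre_of_ne hT hi _ _ (by simpa [Ne.symm hi] using h₀)
          (by simpa using hw.ne'))⟩
      by_cases h : i = i₁
      · subst h; right; simpa [blowup, h₁] using hw
      · left; simp [h]
    · refine ⟨Function.update c i₀ y', fun i => ?_, Or.inl ⟨i₀, Or.inr (by simp)⟩⟩
      by_cases h : i = i₀
      · subst h; right; simpa [blowup, h₀] using hy
      · left; simp [h]
  · exact forcesFrom_passive_of_fibre_of_ne hT hi c y h₀ h₁

/-- A pass is answered only by a cop with `a i = b i`, so the parity of the two-coordinate cops is
kept; a step is answered by all cops. -/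
theorem forcesFrom_passive [Nonempty ι] (hT : ∀ i, (T i).IsTree)
    (hnbr : ∀ v : ∀ i, V i, ∃ w, (cartesianProduct T).Adj v w) (hn : 2 ≤ n)
    (a b : Fin n → ι) (hcov : ∀ j, ∃ i, j = a i ∨ j = b i) (hab : ∃ i, a i = b i)
    (c : Fin n → (∀ i, V i) × Fin t) (y : (∀ i, V i) × Fin t)
    (hc : ∀ i, a i = b i ∨ Even (distSum T (c i).1 y.1)) :
    ForcesFrom (PassiveMove (blowup (cartesianProduct T) t)) c
      {z | PassiveMove (blowup (cartesianProduct T) t) y z} := by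
  induction hp : potentials T a b (fun _ => True) c y using WellFoundedLT.induction
    generalizing c y with
  | _ p ih =>
  subst hp
  by_cases hfib : ∃ i, (c i).1 = y.1
  · obtain ⟨i, hi⟩ := hfib
    exact forcesFrom_passive_of_fibre hT hnbr hn c y hi
  push Not at hfib
  refine forcesFrom_of_step passiveMove_exists ?_
  rintro y' (rfl | hy)
  · obtain ⟨i₀, hi₀⟩ := hab
    obtain ⟨w, hw, hlt⟩ := exists_potential_lt_of_pass hT (a i₀) (hfib i₀)
    refine ⟨Function.update c i₀ (w, y.2), fun i => ?_, Or.inr (ih _ ?_ _ _ (fun i => ?_) rfl)⟩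
    · by_cases h : i = i₀
      · subst h; right; simpa [blowup] using hw
      · left; simp [h]
    · have hlt' : potential T (a i₀) (b i₀) w y.1 < potential T (a i₀) (b i₀) (c i₀).1 y.1 := by
        rwa [← hi₀]
      refine Pi.lt_def.2 ⟨fun i => ?_, ⟨i₀, trivial⟩, by simpa [potentials] using hlt'⟩
      by_cases h : i.1 = i₀
      · simpa [potentials, h] using hlt'.le
      · simp [potentials, h]
    · by_cases h : i = i₀
      · subst h; exact Or.inl hi₀
      · simpa [h] using hc i
  by_cases hfib' : ∃ i, (c i).1 = y'.1
  · obtain ⟨i, hi⟩ := hfib'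
    -- If the robber walks into the fibre of a cop, everyone waits: he is pinned.
    exact ⟨c, fun _ => Or.inl rfl, Or.inr (forcesFrom_passive_of_fibre hT hnbr hn c y' hi)⟩
  push Not at hfib'
  obtain ⟨j, hj, hne⟩ := id hy
  choose w hw hle hlt using fun i => exists_potential_le hT (hfib i) (hfib' i) hj hne (hc i)
  refine ⟨fun i => (w i, y'.2), fun i => Or.inr (hw i), Or.inr (ih _ ?_ _ _ (fun i => ?_) rfl)⟩
  · refine Pi.lt_def.2 ⟨fun i => hle i, ?_⟩
    obtain ⟨i, hji⟩ := hcov j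
    exact ⟨⟨i, trivial⟩, hlt i hji⟩
  · refine (hc i).imp_right fun h => ?_
    show Even (distSum T (w i) y'.1)
    rw [even_distSum_iff_of_adj_left hT _ (hw i), even_distSum_iff_of_adj hT _ hy, not_not]
    exact h

theorem copsWin_passive [Nonempty ι] [∀ i, Nonempty (V i)] (hT : ∀ i, (T i).IsTree)
    (hnbr : ∀ v : ∀ i, V i, ∃ w, (cartesianProduct T).Adj v w) (hn : 2 ≤ n) (ht : 0 < t)
    (a b : Fin n → ι) (hcov : ∀ j, ∃ i, j = a i ∨ j = b i) (hab : ∃ i, a i = b i) :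
    CopsWin (PassiveMove (blowup (cartesianProduct T) t)) n := by
  let x₀ : ∀ i, V i := fun i => Classical.arbitrary _
  obtain ⟨x₁, hx⟩ := hnbr x₀
  refine ForcesFrom.copsWin (c := fun _ => (x₀, ⟨0, ht⟩))
    (forcesFrom_of_step passiveMove_exists fun y _ => ?_)
  by_cases heven : Even (distSum T x₀ y.1)
  · exact ⟨_, fun _ => Or.inl rfl,
      Or.inr (forcesFrom_passive hT hnbr hn a b hcov hab _ _ fun _ => Or.inr heven)⟩
  · refine ⟨fun _ => (x₁, ⟨0, ht⟩), fun _ => Or.inr hx, Or.inr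
      (forcesFrom_passive hT hnbr hn a b hcov hab _ _ fun _ => Or.inr ?_)⟩
    exact (even_distSum_iff_of_adj_left hT y.1 hx).2 heven

theorem copsWin_active [∀ i, Nonempty (V i)] (hT : ∀ i, (T i).IsTree)
    (hnbr : ∀ v : ∀ i, V i, ∃ w, (cartesianProduct T).Adj v w) (ht : 0 < t)
    (a b : Fin n → ι) (s : Fin n → Bool)
    (hcov : ∀ j (e : Bool), ∃ i, s i = e ∧ (j = a i ∨ j = b i)) :
    CopsWin (ActiveMove (blowup (cartesianProduct T) t)) n := by
  let x₀ : ∀ i, V i := fun i => Classical.arbitrary _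
  obtain ⟨x₁, hx⟩ := hnbr x₀
  let x : Bool → ∀ i, V i := fun e => bif e then x₁ else x₀
  have hxx : ∀ e, (cartesianProduct T).Adj (x e) (x !e) := by
    rintro (_ | _)
    exacts [hx, hx.symm]
  refine ForcesFrom.copsWin (c := fun i => (x (s i), ⟨0, ht⟩))
    (forcesFrom_of_step (fun v => (hnbr v.1).imp' (fun w => (w, v.2)) fun _ h => h)
      fun y _ => ⟨fun i => (x (!s i), y.2), fun i => hxx (s i), ?_⟩)
  -- The teams start at the two ends of an edge and have just swapped. They have opposite parities,
  -- so exactly one is at even distance with the robber to move.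
  by_cases hcap : ∃ i, x (!s i) = y.1
  · obtain ⟨i, hi⟩ := hcap
    exact Or.inl ⟨i, Or.inr (Prod.ext hi rfl)⟩
  push Not at hcap
  refine Or.inr (forcesFrom_active hT hnbr a b (fun i => Even (distSum T (x (!s i)) y.1))
    (fun j => ?_) _ _ fun i hi => ⟨hcap i, hi⟩)
  by_cases heven : Even (distSum T (x true) y.1)
  · obtain ⟨i, hi, hj⟩ := hcov j false
    exact ⟨i, by simpa [hi] using heven, hj⟩
  · obtain ⟨i, hi, hj⟩ := hcov j true
    refine ⟨i, ?_, hj⟩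
    simpa [hi] using (even_distSum_iff_of_adj_left hT y.1 (hxx true)).2 heven

end Capture

/-! ### Escape strategies for the robber -/

section Evade

variable {ι : Type} {V : ι → Type u} {T : ∀ i, SimpleGraph (V i)}

theorem exists_adj_cartesianProduct [Nonempty ι] (hV : ∀ i (v : V i), ∃ w, (T i).Adj v w)
    (v : ∀ i, V i) : ∃ w, (cartesianProduct T).Adj v w := by
  classical
  obtain ⟨i⟩ := ‹Nonempty ι›
  obtain ⟨w, hw⟩ := hV i (v i)
  exact ⟨Function.update v i w, i, by simpa using hw, fun j hj => by simp [hj]⟩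

/-- A vertex `u ≠ v` is equal or adjacent to at most one of two neighbours of `v` in directions
other than a fixed direction in which `u` and `v` differ. -/
theorem direction_unique [DecidableEq ι] {u v x : ∀ i, V i} (hx : ∀ i, (T i).Adj (v i) (x i))
    {l i j : ι} (hl : u l ≠ v l) (hil : i ≠ l) (hjl : j ≠ l)
    (hi : u = Function.update v i (x i) ∨
      (cartesianProduct T).Adj u (Function.update v i (x i)))
    (hj : u = Function.update v j (x j) ∨
      (cartesianProduct T).Adj u (Function.update v j (x j))) : i = j := by
  have key : ∀ i, i ≠ l → (u = Function.update v i (x i) ∨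
      (cartesianProduct T).Adj u (Function.update v i (x i))) →
      ∀ m, m ≠ l → u m = Function.update v i (x i) m := by
    -- In the adjacent case the one differing coordinate is `l`, so `u` agrees with the neighbour
    -- everywhere else.
    rintro i hil (h | ⟨p, -, hp⟩) m hm
    · rw [← h]
    · have hlp : l = p := by
        by_contra h
        have := hp l h
        rw [Function.update_of_ne (Ne.symm hil)] at this
        exact hl this
      exact hp m (hlp ▸ hm)
  by_contra hij
  have h1 := key i hil hi i hil
  have h2 := key j hjl hj i hil
  rw [h1, Function.update_self, Function.update_of_ne hij] at h2
  exact (hx i).ne h2.symm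

variable [Fintype ι] {κ : Type}

/-- Few vertices different from `v` cannot dominate all neighbours of `v`. -/
theorem exists_adj_not_dominated (hV : ∀ i (v : V i), ∃ w, (T i).Adj v w) (A : Finset κ)
    (u : κ → ∀ i, V i) (v : ∀ i, V i) (hu : ∀ c ∈ A, u c ≠ v)
    (hA : 2 * A.card < Fintype.card ι) :
    ∃ w, (cartesianProduct T).Adj v w ∧ ∀ c ∈ A, u c ≠ w ∧ ¬ (cartesianProduct T).Adj (u c) w := by
  classical
  choose x hx using fun i => hV i (v i)
  let bad : κ → Finset ι := fun c => {i | u c = Function.update v i (x i) ∨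
    (cartesianProduct T).Adj (u c) (Function.update v i (x i))}
  -- The direction `l` in which the cop differs from `v`, and at most one further direction.
  have hbad : ∀ c ∈ A, (bad c).card ≤ 2 := by
    intro c hc
    obtain ⟨l, hl⟩ := Function.ne_iff.1 (hu c hc)
    have h1 : ((bad c).erase l).card ≤ 1 := Finset.card_le_one.2 fun i hi j hj => by
      simp only [bad, Finset.mem_erase, Finset.mem_filter, Finset.mem_univ, true_and] at hi hj
      exact direction_unique hx hl hi.1 hj.1 hi.2 hj.2
    have h2 := Finset.pred_card_le_card_erase (s := bad c) (a := l)
    omega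
  have hcard := Finset.card_biUnion_le_card_mul A bad 2 hbad
  obtain ⟨i, hi⟩ : ∃ i, i ∉ A.biUnion bad := by
    by_contra! h
    rw [Finset.eq_univ_iff_forall.2 h, Finset.card_univ] at hcard
    omega
  refine ⟨Function.update v i (x i), ⟨i, by simpa using hx i, fun j hj => by simp [hj]⟩,
    fun c hc => ?_⟩
  rw [← not_or]
  exact fun h => hi (Finset.mem_biUnion.2 ⟨c, hc, by simpa [bad] using h⟩)

theorem exists_adj_notMem (hV : ∀ i (v : V i), ∃ w, (T i).Adj v w) (A : Finset κ)
    (u : κ → ∀ i, V i) (v : ∀ i, V i) (hA : A.card < Fintype.card ι) :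
    ∃ w, (cartesianProduct T).Adj v w ∧ ∀ c ∈ A, u c ≠ w := by
  classical
  choose x hx using fun i => hV i (v i)
  have hinj : Function.Injective fun i => Function.update v i (x i) := by
    intro i j hij
    by_contra h
    have := congrFun hij i
    simp only [Function.update_self, Function.update_of_ne h] at this
    exact (hx i).ne this.symm
  obtain ⟨w, hw, hwA⟩ := Finset.exists_mem_notMem_of_card_lt_card
    (s := A.image u) (t := Finset.univ.image fun i => Function.update v i (x i)) (by
      rw [Finset.card_image_of_injective _ hinj, Finset.card_univ]
      exact Finset.card_image_le.trans_lt hA)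
  obtain ⟨i, -, rfl⟩ := Finset.mem_image.1 hw
  exact ⟨_, ⟨i, by simpa using hx i, fun j hj => by simp [hj]⟩,
    fun c hc h => hwA (Finset.mem_image.2 ⟨c, hc, h⟩)⟩

/-- A starting vertex of the robber at distance two from a prescribed vertex. -/
theorem exists_adj_adj_not_dominated (hV : ∀ i (v : V i), ∃ w, (T i).Adj v w) (A : Finset κ)
    (u : κ → ∀ i, V i) (v : ∀ i, V i) (hA : 2 * A.card < Fintype.card ι) :
    ∃ x w, (cartesianProduct T).Adj v x ∧ (cartesianProduct T).Adj x w ∧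
      ∀ c ∈ A, u c ≠ w ∧ ¬ (cartesianProduct T).Adj (u c) w := by
  obtain ⟨x, hx, hxA⟩ := exists_adj_notMem hV A u v (by omega)
  obtain ⟨w, hw, hwA⟩ := exists_adj_not_dominated hV A u x hxA hA
  exact ⟨x, w, hx, hw, hwA⟩

variable {t n : ℕ} [∀ i, Nonempty (V i)]

theorem not_copsWin_passive (hV : ∀ i (v : V i), ∃ w, (T i).Adj v w)
    (ht : 0 < t) (hn : 2 * n < Fintype.card ι) :
    ¬ CopsWin (PassiveMove (blowup (cartesianProduct T) t)) n := by
  have hcard : 2 * (Finset.univ : Finset (Fin n)).card < Fintype.card ι := by simpa using hn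
  refine not_copsWin_of_evade passiveMove_exists
    (fun c y => ∀ i, (c i).1 ≠ y.1 ∧ ¬ (cartesianProduct T).Adj (c i).1 y.1) (fun c => ?_)
    (fun c y h i hi => (h i).1 (congrArg Prod.fst hi)) fun c c' y h hc => ?_
  · obtain ⟨-, w, -, -, hw⟩ := exists_adj_adj_not_dominated hV Finset.univ (fun i => (c i).1)
      (fun i => Classical.arbitrary _) hcard
    exact ⟨(w, ⟨0, ht⟩), fun i => hw i (Finset.mem_univ i)⟩
  · have hne : ∀ i, (c' i).1 ≠ y.1 := by
      intro i hi
      rcases hc i with h' | h'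
      · exact (h i).1 (h' ▸ hi)
      · exact (h i).2 (hi ▸ h')
    obtain ⟨w, hw, hwc⟩ := exists_adj_not_dominated hV Finset.univ (fun i => (c' i).1) y.1
      (fun i _ => hne i) hcard
    exact ⟨fun i hi => hne i (congrArg Prod.fst hi), (w, y.2), Or.inr hw,
      fun i => hwc i (Finset.mem_univ i)⟩

/-- The invariant at the cops' turn: cops outside `A` are at even distance and cannot capture next;
those in `A` are not adjacent to the robber. Since `n < t`, he can enter even an occupied fibre at
an unoccupied copy. -/
theorem not_copsWin_active (hT : ∀ i, (T i).IsTree) (hV : ∀ i (v : V i), ∃ w, (T i).Adj v w)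
    (hodd : Odd (Fintype.card ι)) (hn : n ≤ Fintype.card ι) (ht : n < t) :
    ¬ CopsWin (ActiveMove (blowup (cartesianProduct T) t)) n := by
  classical
  have : Nonempty ι := Fintype.card_pos_iff.1 hodd.pos
  have hnbr := exists_adj_cartesianProduct hV
  have hcopy : ∀ (c : Fin n → (∀ i, V i) × Fin t) (w : ∀ i, V i), ∃ e, ∀ i, c i ≠ (w, e) := by
    intro c w
    obtain ⟨e, -, he⟩ := Finset.exists_mem_notMem_of_card_lt_card
      (s := Finset.univ.image fun i => (c i).2) (t := (Finset.univ : Finset (Fin t))) (by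
        refine Finset.card_image_le.trans_lt ?_
        simpa using ht)
    exact ⟨e, fun i hi => he (Finset.mem_image.2 ⟨i, Finset.mem_univ i, by rw [hi]⟩)⟩
  refine not_copsWin_of_evade (fun v => (hnbr v.1).imp' (fun w => (w, v.2)) fun _ h => h)
    (fun c y => (∀ i, c i ≠ y) ∧ ∃ A : Finset (Fin n), 2 * A.card < Fintype.card ι ∧
      (∀ i ∈ A, ¬ (cartesianProduct T).Adj (c i).1 y.1) ∧
      ∀ i ∉ A, Even (distSum T (c i).1 y.1)) (fun c => ?_) (fun c y h => h.1) fun c c' y h hc => ?_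
  · obtain ⟨p, hp⟩ : ∃ p : ∀ i, V i,
        2 * (Finset.univ.filter fun i => ¬ Even (distSum T (c i).1 p)).card < Fintype.card ι := by
      let p : ∀ i, V i := fun i => Classical.arbitrary _
      obtain ⟨q, hq⟩ := hnbr p
      have h1 := Finset.card_filter_add_card_filter_not (s := (Finset.univ : Finset (Fin n)))
        (fun i => Even (distSum T (c i).1 p))
      rw [Finset.card_univ, Fintype.card_fin] at h1
      by_cases h2 : 2 * (Finset.univ.filter fun i => ¬ Even (distSum T (c i).1 p)).card <
          Fintype.card ι
      · exact ⟨p, h2⟩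
      -- Moving to a neighbour swaps the parity classes; as the number of coordinates is odd and
      -- bounds `n`, one of the classes has less than half of it.
      · refine ⟨q, ?_⟩
        simp only [even_distSum_iff_of_adj hT _ hq, not_not]
        obtain ⟨m, hm⟩ := hodd
        omega
    obtain ⟨x, w, hx, hw, hwA⟩ := exists_adj_adj_not_dominated hV _ (fun i => (c i).1) p hp
    obtain ⟨e, he⟩ := hcopy c w
    refine ⟨(w, e), he, _, hp, fun i hi => (hwA i hi).2, fun i hi => ?_⟩
    rw [even_distSum_iff_of_adj hT _ hw, even_distSum_iff_of_adj hT _ hx, not_not]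
    simpa using hi
  · obtain ⟨-, A, hA, hadj, heven⟩ := h
    have hc : ∀ i, (cartesianProduct T).Adj (c i).1 (c' i).1 := hc
    have hneA : ∀ i ∈ A, (c' i).1 ≠ y.1 := fun i hi h' => hadj i hi (h' ▸ hc i)
    obtain ⟨w, hw, hwA⟩ := exists_adj_not_dominated hV A (fun i => (c' i).1) y.1 hneA hA
    obtain ⟨e, he⟩ := hcopy c' w
    have hflip := fun i => even_distSum_iff_of_adj_left hT y.1 (hc i)
    refine ⟨fun i hi => ?_, (w, e), hw, he, A, hA, fun i hi => (hwA i hi).2, fun i hi => ?_⟩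
    · by_cases hiA : i ∈ A
      · exact hneA i hiA (congrArg Prod.fst hi)
      · have := hflip i
        rw [congrArg Prod.fst hi, distSum_self] at this
        exact this.1 Even.zero (heven i hiA)
    · rw [even_distSum_iff_of_adj hT _ hw, hflip, not_not]
      exact heven i hi

end Evade

end CopsRobbers

theorem mainTheorem3 (k : ℕ) (hk : 2 ≤ k) (V : Fin (2 * k - 1) → Type*)
    [∀ i, Finite (V i)] [∀ i, Nontrivial (V i)]
    (T : ∀ i, SimpleGraph (V i)) (hT : ∀ i, (T i).IsTree) (t : ℕ) (ht : 2 * k ≤ t) :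
    CopsRobbers.passiveCopNumber
        (CopsRobbers.blowup (CopsRobbers.cartesianProduct T) t) = k ∧
      CopsRobbers.activeCopNumber
        (CopsRobbers.blowup (CopsRobbers.cartesianProduct T) t) = 2 * k := by
  have hV : ∀ i (v : V i), ∃ w, (T i).Adj v w := fun i v =>
    (hT i).connected.preconnected.exists_adj_of_nontrivial v
  have : Nonempty (Fin (2 * k - 1)) := ⟨⟨0, by omega⟩⟩
  have hnbr := CopsRobbers.exists_adj_cartesianProduct hV
  have hpassive : CopsRobbers.CopsWin
      (CopsRobbers.PassiveMove (CopsRobbers.blowup (CopsRobbers.cartesianProduct T) t)) k := by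
    refine CopsRobbers.copsWin_passive hT hnbr hk (by omega)
      -- Cop `i` takes coordinates `2i` and `2i + 1`; the `min` leaves the last cop with `2k - 2`
      -- alone.
      (fun i => ⟨2 * i, by omega⟩) (fun i => ⟨min (2 * i + 1) (2 * k - 2), by omega⟩)
      (fun j => ⟨⟨j / 2, by omega⟩, ?_⟩) ⟨⟨k - 1, by omega⟩, ?_⟩
    · simp only [Fin.ext_iff]
      omega
    · simp only [Fin.ext_iff]
      omega
  have hactive : CopsRobbers.CopsWin
      (CopsRobbers.ActiveMove (CopsRobbers.blowup (CopsRobbers.cartesianProduct T) t))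
      (2 * k) := by
    refine CopsRobbers.copsWin_active hT hnbr (by omega)
      -- Cops `2m` and `2m + 1` take the same coordinates, one in each parity team.
      (fun i => ⟨2 * (i / 2), by omega⟩)
      (fun i => ⟨min (2 * (i / 2) + 1) (2 * k - 2), by omega⟩) (fun i => decide (i.1 % 2 = 1))
      (fun j e => ?_)
    have hj := j.2
    cases e
    · refine ⟨⟨2 * (j / 2), by omega⟩, by simp, ?_⟩
      simp only [Fin.ext_iff]
      omega
    · refine ⟨⟨2 * (j / 2) + 1, by omega⟩, by simp, ?_⟩
      simp only [Fin.ext_iff]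
      omega
  constructor
  · refine le_antisymm (Nat.sInf_le hpassive) (le_csInf ⟨k, hpassive⟩ fun n hn => ?_)
    by_contra! h
    exact CopsRobbers.not_copsWin_passive hV (by omega) (by rw [Fintype.card_fin]; omega) hn
  · refine le_antisymm (Nat.sInf_le hactive) (le_csInf ⟨2 * k, hactive⟩ fun n hn => ?_)
    by_contra! h
    refine CopsRobbers.not_copsWin_active hT hV ?_ ?_ (by omega) hn
    · rw [Fintype.card_fin]
      exact ⟨k - 1, by omega⟩
    · rw [Fintype.card_fin]
      omega
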